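/- Let $R$ be a commutative ring in which $2$ is invertible (for example a field of characteristic $\neq 2$), and let $A$ be a unital Jordan algebra over $R$, i.e. a unital, commutative, not necessarily associative $R$-algebra with $(ab)a^2=a(ba^2)$ for all $a,b\in A$. For $a,b\in A$ and $S\subseteq A$ put $$U_ab=2(ab)a-a^2b,\qquad U_a(A)=\{U_ax:x\in A\},\qquad A_+=\{a^2:a\in A\},\qquad U_a(A)_+=U_a(A)\cap A_+,$$ $$S^\perp=\{a\in A: U_ax=0\ \ \forall x\in S\},\qquad {}^\perp S=\{x\in A: U_ax=0\ \ \forall a\in S\},\qquad {}^\perp S_+={}^\perp S\cap A_+.$$ Suppose that $A$ has no nonzero nilpotent elements, i.e. $a^n=0$ with $n\ge 1$ implies $a=0$, where $a^1=a$ and $a^{n+1}=a\,a^n$. Then the following conditions are equivalent: (A1) for every $x\in A_+$ there exists an idempotent $e\in A$ such that $\{x\}^\perp=U_e(A)$; (B1) for every $x\in A$ there exists an idempotent $e\in A$ such that ${}^\perp\{x\}_+=U_e(A)_+$. -/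

import Mathlib

namespace JordanAlg

section Defs

variable {A : Type*} [NonAssocCommRing A]

/-- The powers `a ^ 0 = 1`, `a ^ (n + 1) = a * a ^ n` of an element of a unital (non-associative)
commutative ring. -/
def power (a : A) : ℕ → A
  | 0 => 1
  | n + 1 => a * power a n

/-- The element `a` is nilpotent: some power `a ^ n` with `n ≥ 1` vanishes. -/
def IsNilp (a : A) : Prop := ∃ n : ℕ, 1 ≤ n ∧ power a n = 0

variable (A) in
/-- `A` has no nilpotent elements apart from `0`. -/
def NoNilpotents : Prop := ∀ a : A, IsNilp a → a = 0

variable (A) in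
/-- The set `A₊` of squares. -/
def squares : Set A := {x | ∃ a : A, x = a * a}

/-- The quadratic operator `U_a b = 2 (a b) a - a² b`. -/
def U (a b : A) : A := 2 • ((a * b) * a) - (a * a) * b

/-- `U_a(A) = {U_a x : x ∈ A}`. -/
def URange (a : A) : Set A := {y | ∃ x : A, y = U a x}

/-- `U_a(A)₊ = U_a(A) ∩ A₊`. -/
def URangePos (a : A) : Set A := URange a ∩ squares A

/-- `S^⊥ = {a ∈ A : U_a x = 0 for all x ∈ S}`. -/
def perpRight (S : Set A) : Set A := {a | ∀ x ∈ S, U a x = 0}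

/-- `^⊥S = {x ∈ A : U_a x = 0 for all a ∈ S}`. -/
def perpLeft (S : Set A) : Set A := {x | ∀ a ∈ S, U a x = 0}

/-- `^⊥S₊ = ^⊥S ∩ A₊`. -/
def perpLeftPos (S : Set A) : Set A := perpLeft S ∩ squares A

variable (A) in
/-- Condition (A1): for every `x ∈ A₊` there is an idempotent `e` with `{x}^⊥ = U_e(A)`. -/
def CondA1 : Prop :=
  ∀ x ∈ squares A, ∃ e : A, IsIdempotentElem e ∧ perpRight {x} = URange e

variable (A) in
/-- Condition (B1): for every `x ∈ A` there is an idempotent `e` with `^⊥{x}₊ = U_e(A)₊`. -/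
def CondB1 : Prop :=
  ∀ x : A, ∃ e : A, IsIdempotentElem e ∧ perpLeftPos {x} = URangePos e

end Defs

end JordanAlg

/-! The same idempotent serves `x * x` in (A1) and `x` in (B1), because membership on both sides of
(A1) can be tested on squares. The fundamental formula U_{U_x y} = U_x U_y U_x, applied to 1, gives
(U_x y)² = U_x U_y x². Hence U_a c² = 0 forces (U_c a²)² = U_c U_a U_a c² = 0, so without nilpotents
U_a c² = 0 iff U_c a² = 0, and then even ac = 0. Thus c ∈ {x²}^⊥ iff c² ∈ ^⊥{x}; taking a = 1 - e
shows c² ∈ U_e(A) iff c ∈ U_e(A). -/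

namespace JordanAlg

section TwoTorsion

variable {R A : Type*} [CommRing R] [NonAssocCommRing A] [Module R A]

/-- A module over a ring in which `2` is invertible has no additive `2`-torsion. -/
theorem eq_zero_of_two_nsmul_eq_zero (h2 : IsUnit (2 : R)) (x : A) (hx : 2 • x = 0) : x = 0 := by
  rw [← Nat.cast_smul_eq_nsmul R, Nat.cast_ofNat] at hx
  exact h2.smul_eq_zero.mp hx

end TwoTorsion

section Operators

variable {A : Type*} [NonAssocCommRing A]

local notation "L" => AddMonoid.End.mulLeft

/-- The symmetric bilinear operator `P(a, b)` with `P(a, a) = U_a`. -/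
def opP (a b : A) : AddMonoid.End A := L a * L b + L b * L a - L (a * b)

/-- Half of the operator `V_{a,b} = {a, b, ·}`. -/
def opD (a b : A) : AddMonoid.End A := L (a * b) + L a * L b - L b * L a

theorem opP_comm (a b : A) : opP a b = opP b a := by
  simp only [opP, mul_comm b a]
  abel

theorem opP_add_left (a b c : A) : opP (a + b) c = opP a c + opP b c := by
  simp only [opP, add_mul, mul_add, map_add]
  abel

theorem opP_sub_left (a b c : A) : opP (a - b) c = opP a c - opP b c := by
  simp only [opP, sub_mul, mul_sub, map_sub]
  abel

theorem opP_add_right (a b c : A) : opP a (b + c) = opP a b + opP a c := by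
  rw [opP_comm, opP_add_left, opP_comm b, opP_comm c]

theorem opP_sub_right (a b c : A) : opP a (b - c) = opP a b - opP a c := by
  rw [opP_comm, opP_sub_left, opP_comm b, opP_comm c]

theorem opD_add_left (a b c : A) : opD (a + b) c = opD a c + opD b c := by
  simp only [opD, add_mul, mul_add, map_add]
  abel

theorem opD_sub_left (a b c : A) : opD (a - b) c = opD a c - opD b c := by
  simp only [opD, sub_mul, mul_sub, map_sub]
  abel

theorem opP_self_apply (a b : A) : opP a a b = U a b := by
  change a * (a * b) + a * (a * b) - (a * a) * b = U a b
  rw [U, two_nsmul, mul_comm (a * b) a]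

theorem opP_apply (a b c : A) : opP a b c = a * (b * c) + b * (a * c) - (a * b) * c := rfl

theorem opD_apply (a b c : A) : opD a b c = (a * b) * c + a * (b * c) - b * (a * c) := rfl

theorem opD_apply_eq_opP_apply (a b c : A) : opD a b c = opP a c b := by
  rw [opD_apply, opP_apply, mul_comm c (a * b), mul_comm b (a * c), mul_comm c b]
  abel

theorem U_one (a : A) : U a 1 = a * a := by
  simp only [U, two_nsmul, mul_one]
  abel

theorem U_zero (a : A) : U a 0 = 0 := by
  simp [U]

theorem U_one_left (a : A) : U 1 a = a := by
  simp only [U, two_nsmul, mul_one, one_mul]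
  abel

theorem eq_zero_of_mul_self (hA : NoNilpotents A) {a : A} (h : a * a = 0) : a = 0 :=
  hA a ⟨2, by norm_num, by simpa [power] using h⟩

theorem U_eq_of_idempotent_mul {e x : A} (he : IsIdempotentElem e) (h : e * x = x) :
    U e x = x := by
  rw [U, he.eq, h, mul_comm, h, two_nsmul, add_sub_cancel_right]

end Operators

/-! ### Jordan operator identities, up to the fundamental formula -/

section Jordan

variable {A : Type*} [NonAssocCommRing A]

local notation "L" => AddMonoid.End.mulLeft

theorem end_eq_zero_of_two_nsmul_eq_zero (h2 : ∀ x : A, 2 • x = 0 → x = 0)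
    (φ : AddMonoid.End A) (h : 2 • φ = 0) : φ = 0 := by
  ext d
  apply h2
  rw [two_nsmul] at h ⊢
  exact DFunLike.congr_fun h d

variable [IsCommJordan A]

theorem commutator_cyclic (h2 : ∀ x : A, 2 • x = 0 → x = 0) (a b c : A) :
    L (a * b) * L c - L c * L (a * b) + (L (b * c) * L a - L a * L (b * c))
      + (L (c * a) * L b - L b * L (c * a)) = 0 := by
  have h := two_nsmul_lie_lmul_lmul_add_add_eq_zero a b c
  simp only [Ring.lie_def] at h
  apply end_eq_zero_of_two_nsmul_eq_zero h2
  rw [← neg_eq_zero, ← h]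
  noncomm_ring

theorem jordan_linearized (h2 : ∀ x : A, 2 • x = 0 → x = 0) (a b c d : A) :
    d * ((a * b) * c) + a * ((b * d) * c) + b * ((d * a) * c) =
      (a * b) * (c * d) + (b * c) * (a * d) + (c * a) * (b * d) := by
  have h := congrArg (fun φ : AddMonoid.End A => φ c) (commutator_cyclic h2 a b d)
  change (a * b) * (d * c) - d * ((a * b) * c) + ((b * d) * (a * c) - a * ((b * d) * c))
    + ((d * a) * (b * c) - b * ((d * a) * c)) = 0 at h
  rw [mul_comm c d, mul_comm c a, mul_comm a d, mul_comm (b * c), mul_comm (a * c) (b * d)]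
  rw [← sub_eq_zero, ← neg_eq_zero, ← h]
  abel

/-- Rewrites multiplication by a cubic product through products of at most two factors, so that the
identities below become associative computations modulo commutator relations. -/
theorem mulLeft_mul_mul (h2 : ∀ x : A, 2 • x = 0 → x = 0) (a b c : A) :
    L ((a * b) * c) = L (a * b) * L c + L (b * c) * L a + L (c * a) * L b
      - L a * L c * L b - L b * L c * L a := by
  ext d
  have h := jordan_linearized h2 a b c d
  change ((a * b) * c) * d = (a * b) * (c * d) + (b * c) * (a * d) + (c * a) * (b * d)
    - a * (c * (b * d)) - b * (c * (a * d))
  rw [← h, mul_comm c (b * d), mul_comm c (a * d), mul_comm a d, mul_comm _ d]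
  abel

theorem mulLeft_comm_mulLeft_sq (a : A) : L (a * a) * L a = L a * L (a * a) :=
  (commute_lmul_lmul_sq a).eq.symm

theorem commutator_sq (h2 : ∀ x : A, 2 • x = 0 → x = 0) (a b : A) :
    L (a * a) * L b - L b * L (a * a) + 2 • (L (a * b) * L a - L a * L (a * b)) = 0 := by
  have h := commutator_cyclic h2 a a b
  rw [mul_comm b a] at h
  rw [← h]
  abel

theorem opD_mul_opP (h2 : ∀ x : A, 2 • x = 0 → x = 0) (x y : A) :
    opD x y * opP x x = opP (U x y) x := by
  have hS := mulLeft_comm_mulLeft_sq x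
  have hxy := commutator_sq h2 x y
  have hxxy := commutator_sq h2 x (x * y)
  rw [mul_comm x (x * y), mulLeft_mul_mul h2] at hxxy
  simp only [U, opD, opP, two_nsmul, add_mul, sub_mul, map_add, map_sub, mulLeft_mul_mul h2,
    mul_comm y x, mul_comm x (x * x), mul_comm x (x * y)] at hxy hxxy ⊢
  generalize (L x : AddMonoid.End A) = X at *
  generalize (L y : AddMonoid.End A) = Y at *
  generalize (L (x * x) : AddMonoid.End A) = S at *
  generalize (L (x * y) : AddMonoid.End A) = Q at *
  linear_combination (norm := noncomm_ring) -2 * hS * Y + X * hxy - 2 * hxy * X - 2 * Y * hS + 2 * hxxy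

theorem opP_mul_opD (h2 : ∀ x : A, 2 • x = 0 → x = 0) (x y : A) :
    opP x x * opD y x = opP (U x y) x := by
  have hS := mulLeft_comm_mulLeft_sq x
  have hxy := commutator_sq h2 x y
  have hxxy := commutator_sq h2 x (x * y)
  rw [mul_comm x (x * y), mulLeft_mul_mul h2] at hxxy
  simp only [U, opD, opP, two_nsmul, add_mul, sub_mul, map_add, map_sub, mulLeft_mul_mul h2,
    mul_comm y x, mul_comm x (x * x), mul_comm x (x * y)] at hxy hxxy ⊢
  generalize (L x : AddMonoid.End A) = X at *
  generalize (L y : AddMonoid.End A) = Y at *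
  generalize (L (x * x) : AddMonoid.End A) = S at *
  generalize (L (x * y) : AddMonoid.End A) = Q at *
  linear_combination (norm := noncomm_ring) -hS * Y - hxy * X - Y * hS + hxxy

theorem opD_U_left (h2 : ∀ x : A, 2 • x = 0 → x = 0) (x y : A) :
    opD (U x y) y = opD x (U y x) := by
  have hxy := commutator_sq h2 x y
  have hyx := commutator_sq h2 y x
  have hxxyy := commutator_sq h2 x (y * y)
  rw [mul_comm x (y * y), mulLeft_mul_mul h2] at hxxyy
  simp only [U, opD, two_nsmul, add_mul, sub_mul, mul_add, mul_sub, map_add, map_sub,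
    mulLeft_mul_mul h2, mul_comm y x, mul_comm x (_ * _), mul_comm y (_ * _)] at hxy hyx hxxyy ⊢
  generalize (L x : AddMonoid.End A) = X at *
  generalize (L y : AddMonoid.End A) = Y at *
  generalize (L (x * x) : AddMonoid.End A) = S at *
  generalize (L (y * y) : AddMonoid.End A) = T at *
  generalize (L (x * y) : AddMonoid.End A) = Q at *
  linear_combination (norm := noncomm_ring) -Y * hxy + X * hyx + hxxyy

theorem two_nsmul_opD_mul_opD (h2 : ∀ x : A, 2 • x = 0 → x = 0) (x y : A) :
    2 • (opD x y * opD x y) = opD x (U y x) + opP x x * opP y y := by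
  have hyx := commutator_sq h2 y x
  simp only [U, opD, opP, two_nsmul, add_mul, sub_mul, mul_add, mul_sub, map_add, map_sub,
    mulLeft_mul_mul h2, mul_comm y x, mul_comm x (_ * _)] at hyx ⊢
  generalize (L x : AddMonoid.End A) = X at *
  generalize (L y : AddMonoid.End A) = Y at *
  generalize (L (x * x) : AddMonoid.End A) = S at *
  generalize (L (y * y) : AddMonoid.End A) = T at *
  generalize (L (x * y) : AddMonoid.End A) = Q at *
  linear_combination (norm := noncomm_ring) -X * hyx

theorem opD_mul_opP_linearized (h2 : ∀ x : A, 2 • x = 0 → x = 0) (x y z : A) :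
    opD z y * opP x x + 2 • (opD x y * opP x z) =
      opP (U x y) z + 2 • opP (opP x z y) x := by
  have hadd := opD_mul_opP h2 (x + z) y
  have hsub := opD_mul_opP h2 (x - z) y
  have hz := opD_mul_opP h2 z y
  have eadd : U (x + z) y = U x y + U z y + (opP x z y + opP x z y) := by
    simp only [← opP_self_apply, opP_add_left, opP_add_right, opP_comm z x]
    change opP x x y + opP x z y + (opP x z y + opP z z y) = _
    abel
  have esub : U (x - z) y = U x y + U z y - (opP x z y + opP x z y) := by
    simp only [← opP_self_apply, opP_sub_left, opP_sub_right, opP_comm z x]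
    change opP x x y - opP x z y - (opP x z y - opP z z y) = _
    abel
  rw [eadd] at hadd
  rw [esub] at hsub
  -- Polarization: the difference of the cases x ± z is twice the part odd in z; removing the cubic
  -- term `hz` leaves the linear part.
  simp only [opP_add_left, opP_add_right, opP_sub_left, opP_sub_right, opD_add_left,
    opD_sub_left, opP_comm z x] at hadd hsub
  rw [← sub_eq_zero]
  apply end_eq_zero_of_two_nsmul_eq_zero h2
  rw [← sub_eq_zero] at hadd hsub hz
  linear_combination (norm := noncomm_ring) hadd - hsub - 2 * hz

/-- The fundamental formula `U_{U_x y} = U_x U_y U_x`. -/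
theorem fundamental_formula (h2 : ∀ x : A, 2 • x = 0 → x = 0) (x y : A) :
    opP (U x y) (U x y) = opP x x * opP y y * opP x x := by
  -- With z = U_x y, every term becomes a multiple of U_x on the right, except the wanted one.
  have h := opD_mul_opP_linearized h2 x y (U x y)
  have hp : opP x (U x y) = opD x y * opP x x := by
    rw [opP_comm, opD_mul_opP h2]
  have hpy : opP x (U x y) y = U x (U y x) := by
    rw [opP_comm, ← opP_mul_opD h2]
    change opP x x (opD y x y) = _
    rw [opD_apply_eq_opP_apply, opP_self_apply, opP_self_apply]
  have hD := two_nsmul_opD_mul_opD h2 x y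
  rw [hpy, ← opD_mul_opP h2 x (U y x), hp, opD_U_left h2] at h
  linear_combination (norm := noncomm_ring) -h + hD * opP x x

/-! ### Orthogonality and idempotents -/

theorem U_U (h2 : ∀ x : A, 2 • x = 0 → x = 0) (x y z : A) :
    U (U x y) z = U x (U y (U x z)) := by
  have h := DFunLike.congr_fun (fundamental_formula h2 x y) z
  simpa only [opP_self_apply] using h.trans (show _ = opP x x (opP y y (opP x x z)) from rfl)

theorem U_mul_self (h2 : ∀ x : A, 2 • x = 0 → x = 0) (x y : A) :
    U x y * U x y = U x (U y (x * x)) := by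
  rw [← U_one, U_U h2, U_one]

theorem U_sq (h2 : ∀ x : A, 2 • x = 0 → x = 0) (x y : A) :
    U (x * x) y = U x (U x y) := by
  rw [← U_one x, U_U h2, U_one_left]

/-- Each term on the right vanishes for orthogonal a and c, which yields ac = 0. -/
theorem four_nsmul_mul_sq (h2 : ∀ x : A, 2 • x = 0 → x = 0) (a c : A) :
    4 • ((a * c) * (a * c)) = 2 • (c * U a c) + U a (c * c) + U c (a * a) := by
  have h := jordan_linearized h2 c c a a
  rw [← sub_eq_zero] at h ⊢
  rw [mul_comm c a, mul_comm (a * c) a, mul_comm (c * c) a] at h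
  have h' := congrArg (fun t : A => -(2 • t)) h
  simp only [smul_zero, neg_zero] at h'
  rw [← h']
  simp only [U, mul_sub, mul_add, two_nsmul, mul_comm c (a * a), mul_comm (a * c) a,
    mul_comm (a * (c * c)) a, mul_comm (c * c) (a * a), mul_comm (a * a * c) c]
  abel

/-- Orthogonality of squares is symmetric when there are no nilpotents. -/
theorem U_mul_self_eq_zero_symm (h2 : ∀ x : A, 2 • x = 0 → x = 0) (hA : NoNilpotents A) {a c : A}
    (h : U a (c * c) = 0) : U c (a * a) = 0 := by
  apply eq_zero_of_mul_self hA
  rw [U_mul_self h2, U_sq h2, h, U_zero, U_zero]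

theorem mul_eq_zero_of_U_mul_self (h2 : ∀ x : A, 2 • x = 0 → x = 0) (hA : NoNilpotents A)
    {a c : A} (h : U a (c * c) = 0) : a * c = 0 := by
  have h' := U_mul_self_eq_zero_symm h2 hA h
  have hac : U a c = 0 := by
    apply eq_zero_of_mul_self hA
    rw [U_mul_self h2, h', U_zero]
  have h4 := four_nsmul_mul_sq h2 a c
  rw [hac, h, h', mul_zero, smul_zero, add_zero, add_zero] at h4
  apply eq_zero_of_mul_self hA
  apply h2
  apply h2
  rw [← mul_nsmul]
  exact h4

theorem idempotent_mul_U (h2 : ∀ x : A, 2 • x = 0 → x = 0) {e : A} (he : IsIdempotentElem e)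
    (x : A) : e * U e x = U e x := by
  have h := jordan_linearized h2 e e e x
  have hee : e * e = e := he
  simp only [hee, mul_comm x e, mul_comm (e * x) e] at h
  simp only [U, hee, two_nsmul, mul_sub, mul_add, mul_comm (e * x) e]
  rw [← sub_eq_zero] at h ⊢
  rw [← h]
  abel

theorem mem_URange_iff (h2 : ∀ x : A, 2 • x = 0 → x = 0) {e : A} (he : IsIdempotentElem e)
    (x : A) : x ∈ URange e ↔ e * x = x := by
  constructor
  · rintro ⟨y, rfl⟩
    exact idempotent_mul_U h2 he y
  · exact fun h => ⟨x, (U_eq_of_idempotent_mul he h).symm⟩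

theorem mul_self_mem_URange_iff (h2 : ∀ x : A, 2 • x = 0 → x = 0) (hA : NoNilpotents A) {e : A}
    (he : IsIdempotentElem e) (c : A) : c * c ∈ URange e ↔ c ∈ URange e := by
  rw [mem_URange_iff h2 he, mem_URange_iff h2 he]
  have hee : e * e = e := he
  constructor
  · intro h
    have hf : U (1 - e) (c * c) = 0 := by
      have h0 : (1 - e) * (c * c) = 0 := by rw [sub_mul, one_mul, h, sub_self]
      have hff : (1 - e) * (1 - e) = 1 - e := by
        rw [mul_sub, mul_one, sub_mul, one_mul, hee, sub_self, sub_zero]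
      rw [U, hff, h0, zero_mul, smul_zero, sub_zero]
    have h' := mul_eq_zero_of_U_mul_self h2 hA hf
    rw [sub_mul, one_mul, sub_eq_zero] at h'
    exact h'.symm
  · intro h
    -- With ec = c the identity reads c² + 2ec² = ec² + 2c².
    have hj := jordan_linearized h2 e e c c
    simp only [hee, mul_comm c e, h] at hj
    rw [← sub_eq_zero] at hj ⊢
    rw [← hj]
    abel

theorem condA1_iff_condB1 (h2 : ∀ x : A, 2 • x = 0 → x = 0) (hA : NoNilpotents A) :
    CondA1 A ↔ CondB1 A := by
  have hU (a c : A) : U a (c * c) = 0 ↔ U c (a * a) = 0 :=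
    ⟨U_mul_self_eq_zero_symm h2 hA, U_mul_self_eq_zero_symm h2 hA⟩
  have key (x e : A) (he : IsIdempotentElem e) :
      perpRight {x * x} = URange e ↔ perpLeftPos {x} = URangePos e := by
    simp only [Set.ext_iff, perpRight, perpLeftPos, perpLeft, URangePos, Set.mem_inter_iff,
      Set.mem_ofPred_eq, Set.mem_singleton_iff, forall_eq]
    constructor
    · intro h y
      refine and_congr_left ?_
      rintro ⟨c, rfl⟩
      rw [hU, h, mul_self_mem_URange_iff h2 hA he]
    · intro h c
      have hc := h (c * c)
      rw [and_congr_left_iff] at hc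
      rw [hU, hc ⟨c, rfl⟩, mul_self_mem_URange_iff h2 hA he]
  constructor
  · intro h x
    obtain ⟨e, he, hx⟩ := h (x * x) ⟨x, rfl⟩
    exact ⟨e, he, (key x e he).1 hx⟩
  · rintro h _ ⟨x, rfl⟩
    obtain ⟨e, he, hx⟩ := h x
    exact ⟨e, he, (key x e he).2 hx⟩

end Jordan

end JordanAlg

theorem theorem1p7 {R A : Type*} [CommRing R] (h2 : IsUnit (2 : R))
    [NonAssocCommRing A] [Module R A] [IsScalarTower R A A] [SMulCommClass R A A]
    [IsCommJordan A] (hA : JordanAlg.NoNilpotents A) :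
    JordanAlg.CondA1 A ↔ JordanAlg.CondB1 A :=
  JordanAlg.condA1_iff_condB1 (JordanAlg.eq_zero_of_two_nsmul_eq_zero h2) hA
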